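/- Here a triangulated model with $n$ triangles is a finite geometric simplicial complex in some $\mathbb{R}^d$ (in particular $d=3$) consisting of $n$ triangles together with their edges and vertices, such that every edge lies in one triangle (a boundary edge, at a hole of the model) or in two triangles; holes are allowed. A model is connected if it has at least one triangle and any two of its triangles are joined by a chain of triangles in which consecutive triangles share an edge. (For a triangulated surface with boundary this is the same as connectedness of the surface.) A subdivision of a model $K$ is a model $L$ that covers the same point set, each of whose simplices lies in a simplex of $K$, and each of whose vertices is a vertex of $K$ or the midpoint of an edge of $K$. A single triangle strip of $L$ is an ordering of all triangles of $L$, each occurring exactly once, in which consecutive triangles share an edge. Theorem. There is an absolute constant $C$ such that every connected triangulated model with $n$ triangles, with or without holes, has a subdivision that forms a single triangle strip with at most $$3n-4\log_2 n+C$$ triangles. -/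

import Mathlib

namespace Strip

/-- The space `ℝ^d`. -/
abbrev Space (d : ℕ) := EuclideanSpace ℝ (Fin d)

/-- A simplicial complex in `ℝ^d`. -/
abbrev Complex (d : ℕ) := Geometry.SimplicialComplex ℝ (Space d)

/-- The triangles of a complex: its faces with three vertices. -/
def triangles {d : ℕ} (K : Complex d) : Set (Finset (Space d)) :=
  {t | t ∈ K.faces ∧ t.card = 3}

/-- A triangulated model: finitely many triangles of `ℝ^d` (with their edges and vertices) that meet
edge-to-edge, every edge lying in one triangle (a boundary edge) or in two triangles. -/
structure IsModel {d : ℕ} (K : Complex d) : Prop where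
  finite : K.faces.Finite
  pure : ∀ s ∈ K.faces, ∃ t ∈ triangles K, s ⊆ t
  edge_le_two : ∀ e ∈ K.faces, e.card = 2 → {t | t ∈ triangles K ∧ e ⊆ t}.encard ≤ 2

/-- Two different triangles that have an edge in common. -/
def ShareEdge {d : ℕ} (s t : Finset (Space d)) : Prop :=
  s ≠ t ∧ ∃ e : Finset (Space d), e.card = 2 ∧ e ⊆ s ∧ e ⊆ t

/-- The dual graph: its nodes are the triangles, two of them joined if they share an edge. -/
def dualGraph {d : ℕ} (K : Complex d) : SimpleGraph (triangles K) where
  Adj s t := ShareEdge s.1 t.1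
  symm := ⟨fun _ _ h => ⟨h.1.symm, h.2.imp fun _ he => ⟨he.1, he.2.2, he.2.1⟩⟩⟩
  loopless := ⟨fun _ h => h.1 rfl⟩

/-- Connectedness of a model: there is a triangle, and any two triangles are joined by a chain of
triangles in which consecutive ones share an edge. -/
def EdgeConnected {d : ℕ} (K : Complex d) : Prop := (dualGraph K).Connected

/-- `L` subdivides `K`: both cover the same point set, every simplex of `L` lies in a simplex of
`K`, and every vertex of `L` is a vertex of `K` or the midpoint of an edge of `K`. -/
structure IsSubdivision {d : ℕ} (K L : Complex d) : Prop where
  space_eq : L.space = K.space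
  refines : ∀ s ∈ L.faces, ∃ t ∈ K.faces,
    convexHull ℝ (s : Set (Space d)) ⊆ convexHull ℝ (t : Set (Space d))
  midpoints : ∀ x ∈ L.vertices, x ∈ K.vertices ∨
    ∃ e ∈ K.faces, e.card = 2 ∧ ∃ a ∈ e, ∃ b ∈ e, a ≠ b ∧ x = midpoint ℝ a b

/-- `l` is a single triangle strip of `L`: it lists every triangle of `L` exactly once, and
consecutive triangles share an edge. -/
structure IsStrip {d : ℕ} (L : Complex d) (l : List (Finset (Space d))) : Prop where
  nodup : l.Nodup
  mem_iff : ∀ t, t ∈ l ↔ t ∈ triangles L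
  chain : l.IsChain ShareEdge

/-- Why `EdgeConnected` is the right notion: if the triangles around every vertex form a single
fan (the condition for a surface with boundary to be a manifold at that vertex), a model whose
underlying space is connected is edge-connected. -/
theorem edgeConnected_of_isConnected_space {d : ℕ} {K : Complex d} (hK : IsModel K)
    (hfan : ∀ v : Space d, ((dualGraph K).induce {t | v ∈ t.1}).Preconnected)
    (hconn : IsConnected K.space) : EdgeConnected K := by
  classical
  have hne : Nonempty (triangles K) := by
    obtain ⟨x, hx⟩ := hconn.nonempty
    obtain ⟨s, hs, -⟩ := Geometry.SimplicialComplex.mem_space_iff.1 hx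
    obtain ⟨t, ht, -⟩ := hK.pure s hs
    exact ⟨⟨t, ht⟩⟩
  have hfin : (triangles K).Finite := hK.finite.subset fun t ht => ht.1
  have : Finite (triangles K) := hfin
  refine (SimpleGraph.connected_iff _).2 ⟨fun s t => ?_, hne⟩
  by_contra hst
  let A : Set (Space d) := ⋃ u : {u : triangles K // (dualGraph K).Reachable s u},
    convexHull ℝ (u.1.1 : Set (Space d))
  let B : Set (Space d) := ⋃ u : {u : triangles K // ¬ (dualGraph K).Reachable s u},
    convexHull ℝ (u.1.1 : Set (Space d))
  have hcl : ∀ u : Finset (Space d), IsClosed (convexHull ℝ (u : Set (Space d))) := fun u =>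
    (Set.Finite.isCompact_convexHull ℝ u.finite_toSet).isClosed
  have hA : IsClosed A := isClosed_iUnion_of_finite fun u => hcl _
  have hB : IsClosed B := isClosed_iUnion_of_finite fun u => hcl _
  have hcov : K.space ⊆ A ∪ B := by
    intro x hx
    obtain ⟨u, hu, hxu⟩ := Geometry.SimplicialComplex.mem_space_iff.1 hx
    obtain ⟨w, hw, huw⟩ := hK.pure u hu
    have hxw : x ∈ convexHull ℝ (w : Set (Space d)) :=
      convexHull_mono (Finset.coe_subset.2 huw) hxu
    by_cases h : (dualGraph K).Reachable s ⟨w, hw⟩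
    · exact Or.inl (Set.mem_iUnion.2 ⟨⟨⟨w, hw⟩, h⟩, hxw⟩)
    · exact Or.inr (Set.mem_iUnion.2 ⟨⟨⟨w, hw⟩, h⟩, hxw⟩)
  have hmeet : ∀ u : triangles K, ∃ x, x ∈ K.space ∧ x ∈ convexHull ℝ (u.1 : Set (Space d)) := by
    intro u
    obtain ⟨x, hx⟩ := Geometry.SimplicialComplex.nonempty_of_mem_faces u.2.1
    exact ⟨x, Geometry.SimplicialComplex.subset_space u.2.1 hx, subset_convexHull ℝ _ hx⟩
  have hsA : (K.space ∩ A).Nonempty := by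
    obtain ⟨x, hx, hxs⟩ := hmeet s
    exact ⟨x, hx, Set.mem_iUnion.2 ⟨⟨s, SimpleGraph.Reachable.refl s⟩, hxs⟩⟩
  have htB : (K.space ∩ B).Nonempty := by
    obtain ⟨x, hx, hxt⟩ := hmeet t
    exact ⟨x, hx, Set.mem_iUnion.2 ⟨⟨t, hst⟩, hxt⟩⟩
  obtain ⟨x, -, hxA, hxB⟩ :=
    isPreconnected_closed_iff.1 hconn.isPreconnected A B hA hB hcov hsA htB
  obtain ⟨⟨u, hu⟩, hxu⟩ := Set.mem_iUnion.1 hxA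
  obtain ⟨⟨w, hw⟩, hxw⟩ := Set.mem_iUnion.1 hxB
  have hx := K.inter_subset_convexHull u.2.1 w.2.1 ⟨hxu, hxw⟩
  obtain ⟨v, hvu, hvw⟩ := convexHull_nonempty_iff.1 ⟨x, hx⟩
  have hr := hfan v ⟨u, hvu⟩ ⟨w, hvw⟩
  exact hw (hu.trans (hr.map (SimpleGraph.Embedding.induce _).toHom))

end Strip

/-! Absorbing one triangle into a strip is cheap. Let a strip pass through a triangle `s`, and let
`t` be a triangle off the strip beyond the edge `ab` of `s`. Bisect `ab` at its midpoint. This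
halves `s` and `t` and no other triangle, because an edge lies in at most two triangles. The strip
can now run through the half of `s` at `a`, the half of `t` at `a`, the half of `t` at `b` and the
half of `s` at `b`. It gains three triangles, and the triangles still missing are untouched
triangles of the original model (`IsPartialStrip.exists_bisect`). A strip of `k` original triangles
thus grows to a full strip with `k + 3 (n - k) = 3 n - 2 k` triangles.

It remains to start with `k` at least `2 log₂ n - 3`. The dual graph is connected with degrees at
most three. Cut it into two connected parts of comparable sizes, joined by an edge
(`Linked.exists_balanced_partition`). From its end of that edge, a path in each part that always
enters the larger remaining piece loses only about half of the nodes per step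
(`Linked.exists_path`). The two paths joined across the edge have total length about `2 log₂ n`
(`Linked.exists_long_path`).

The geometric work is to show that bisecting an edge gives a simplicial complex again (`bisect`) and
a model again (`IsTriangulated.bisect`). -/

namespace Strip

/-! ### Long paths in connected graphs of maximal degree three -/

section Linked

variable {α : Type*} [DecidableEq α] {r : α → α → Prop}

/-- A finite set is linked by `r` if `r` leads out of each of its proper nonempty subsets. -/
def Linked (r : α → α → Prop) (S : Finset α) : Prop :=
  ∀ X ⊆ S, X.Nonempty → X ≠ S → ∃ x ∈ X, ∃ y ∈ S \ X, r x y

theorem linked_singleton (a : α) : Linked r {a} := by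
  intro X hX hne hXa
  rcases Finset.subset_singleton_iff.1 hX with h | h
  · exact absurd h hne.ne_empty
  · exact absurd h hXa

theorem Linked.union (hr : ∀ x y, r x y → r y x) {A B : Finset α} (hA : Linked r A)
    (hB : Linked r B) {a b : α} (ha : a ∈ A) (hb : b ∈ B) (hab : r a b) : Linked r (A ∪ B) := by
  intro X hX hne hXu
  by_cases h1 : (X ∩ A).Nonempty ∧ X ∩ A ≠ A
  · obtain ⟨x, hx, y, hy, hxy⟩ := hA _ Finset.inter_subset_right h1.1 h1.2
    exact ⟨x, by grind, y, by grind, hxy⟩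
  by_cases h2 : (X ∩ B).Nonempty ∧ X ∩ B ≠ B
  · obtain ⟨x, hx, y, hy, hxy⟩ := hB _ Finset.inter_subset_right h2.1 h2.2
    exact ⟨x, by grind, y, by grind, hxy⟩
  by_cases haX : a ∈ X
  · have hAX : X ∩ A = A := by
      by_contra h
      exact h1 ⟨⟨a, Finset.mem_inter.2 ⟨haX, ha⟩⟩, h⟩
    refine ⟨a, haX, b, ?_, hab⟩
    have : b ∉ X := by
      intro hbX
      have hBX : X ∩ B = B := by
        by_contra h
        exact h2 ⟨⟨b, Finset.mem_inter.2 ⟨hbX, hb⟩⟩, h⟩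
      exact hXu (by grind)
    grind
  · have hAX : X ∩ A = ∅ := by
      by_contra h
      exact h1 ⟨Finset.nonempty_iff_ne_empty.2 h, by grind⟩
    obtain ⟨z, hz⟩ := hne
    have hzB : z ∈ B := by
      have : z ∉ X ∩ A := by simp [hAX]
      have := hX hz
      grind
    have hBX : X ∩ B = B := by
      by_contra h
      exact h2 ⟨⟨z, Finset.mem_inter.2 ⟨hz, hzB⟩⟩, h⟩
    exact ⟨b, by grind, a, by grind, hr _ _ hab⟩

theorem Linked.insert_of_rel (hr : ∀ x y, r x y → r y x) {A : Finset α} (hA : Linked r A)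
    {a b : α} (ha : a ∈ A) (hab : r a b) : Linked r (insert b A) := by
  have := hA.union hr (linked_singleton b) ha (Finset.mem_singleton_self b) hab
  rwa [Finset.union_comm, ← Finset.insert_eq] at this

/-- Among the linked subsets of `S` that contain `b` there is a largest one. -/
theorem exists_maximal_linked {S : Finset α} {b : α} (hb : b ∈ S) :
    ∃ A ⊆ S, b ∈ A ∧ Linked r A ∧ ∀ B ⊆ S, b ∈ B → Linked r B → B.card ≤ A.card := by
  classical
  obtain ⟨A, hA, hmax⟩ := Finset.exists_max_image
    (S.powerset.filter fun A => b ∈ A ∧ Linked r A) Finset.card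
    ⟨{b}, by simp [hb, linked_singleton]⟩
  simp only [Finset.mem_filter, Finset.mem_powerset] at hA hmax
  exact ⟨A, hA.1, hA.2.1, hA.2.2, fun B h1 h2 h3 => hmax B ⟨h1, h2, h3⟩⟩

/-- Removing from a linked set an element with at most two neighbours leaves two sets, each of them
empty or linked and adjacent to the removed element. -/
theorem Linked.exists_split (hr : ∀ x y, r x y → r y x) {S : Finset α} (hS : Linked r S) {a : α}
    (ha : a ∈ S) (hdeg : ∀ N ⊆ S, (∀ x ∈ N, r a x) → a ∉ N → N.card ≤ 2) :
    ∃ A B : Finset α, Disjoint A B ∧ A ∪ B = S.erase a ∧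
      (A = ∅ ∨ Linked r A ∧ ∃ b ∈ A, r a b) ∧ (B = ∅ ∨ Linked r B ∧ ∃ b ∈ B, r a b) := by
  by_cases hSa : {a} = S
  · exact ⟨∅, ∅, by simp, by simp [← hSa], Or.inl rfl, Or.inl rfl⟩
  obtain ⟨x, hx, b, hb, hab⟩ := hS {a} (by simpa using ha) (by simp) hSa
  obtain rfl := Finset.mem_singleton.1 hx
  have hbS : b ∈ S.erase x := by grind
  obtain ⟨A, hAS, hbA, hA, hmax⟩ := exists_maximal_linked (r := r) hbS
  -- By maximality of `A`, every exit from `A` inside `S` leads to the removed element.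
  have hclosed : ∀ u ∈ A, ∀ v ∈ S, v ∉ A → r u v → v = x := by
    intro u hu v hv hvA huv
    by_contra hvx
    have h := hmax (insert v A) (by grind) (by grind) (hA.insert_of_rel hr hu huv)
    rw [Finset.card_insert_of_notMem hvA] at h
    omega
  refine ⟨A, S.erase x \ A, Finset.disjoint_sdiff, Finset.union_sdiff_of_subset hAS,
    Or.inr ⟨hA, b, hbA, hab⟩, ?_⟩
  by_cases hB : S.erase x \ A = ∅
  · exact Or.inl hB
  right
  have hexit : ∀ X ⊆ S.erase x \ A, X.Nonempty →
      (∃ u ∈ X, r x u) ∨ ∃ u ∈ X, ∃ v ∈ (S.erase x \ A) \ X, r u v := by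
    intro X hX hne
    obtain ⟨u, hu, v, hv, huv⟩ := hS X (by grind) hne (by grind)
    have huB := hX hu
    by_cases hvx : v = x
    · exact Or.inl ⟨u, hu, hvx ▸ hr _ _ huv⟩
    by_cases hvA : v ∈ A
    · have := hclosed v hvA u (by grind) (by grind) (hr _ _ huv)
      grind
    · exact Or.inr ⟨u, hu, v, by grind, huv⟩
  -- One of the two neighbours is already spent on `b ∈ A`. Hence a set `X` and its complement in
  -- the rest cannot both have `x` as their only exit, which makes the rest linked.
  have hone : ∀ u ∈ S.erase x \ A, ∀ v ∈ S.erase x \ A, r x u → r x v → u = v := by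
    intro u hu v hv hxu hxv
    by_contra huv
    have h := hdeg {b, u, v} (by grind) (by grind) (by grind)
    have : ({b, u, v} : Finset α).card = 3 := Finset.card_eq_three.2
      ⟨b, u, v, by grind, by grind, huv, rfl⟩
    omega
  constructor
  · intro X hX hne hXB
    rcases hexit X hX hne with ⟨u, hu, hxu⟩ | h
    · rcases hexit ((S.erase x \ A) \ X) Finset.sdiff_subset (by
        rw [Finset.sdiff_nonempty]
        exact fun h => hXB (hX.antisymm h)) with ⟨v, hv, hxv⟩ | ⟨v, hv, w, hw, hvw⟩
      · have := hone u (hX hu) v (by grind) hxu hxv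
        grind
      · exact ⟨w, by grind, v, hv, hr _ _ hvw⟩
    · exact h
  · rcases hexit _ subset_rfl (Finset.nonempty_iff_ne_empty.2 hB) with h | ⟨u, hu, v, hv, -⟩
    · exact h
    · simp at hv

/-- A linked set of maximal degree three, with an outer neighbour at `a`, contains a path from `a`
whose length is at least logarithmic. -/
theorem Linked.exists_path (hr : ∀ x y, r x y → r y x) {S : Finset α} (hS : Linked r S) {a : α}
    (ha : a ∈ S) {T : Finset α} (hST : S ⊆ T) (hdeg : ∀ x ∈ T, ∀ N ⊆ T, (∀ y ∈ N, r x y) → N.card ≤ 3)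
    {z : α} (hz : z ∈ T) (hzS : z ∉ S) (haz : r a z) :
    ∃ l : List α, (∀ x ∈ l, x ∈ S) ∧ l.Nodup ∧ l.IsChain r ∧ l.head? = some a ∧
      S.card + 1 ≤ 2 ^ l.length := by
  induction hn : S.card using Nat.strong_induction_on generalizing S a z with
  | _ n ih =>
  subst hn
  -- The outer neighbour `z`, which is the preceding node of the path in the recursion, uses up one
  -- of the three neighbours of `a`.
  obtain ⟨A, B, hAB, hun, hA, hB⟩ := hS.exists_split hr ha (fun N hN hN' _ => by
    have h := hdeg a (hST ha) (insert z N) (by grind) (by grind)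
    rw [Finset.card_insert_of_notMem (by grind)] at h
    omega)
  have hcard : S.card = A.card + B.card + 1 := by
    rw [← Finset.card_union_of_disjoint hAB, hun, Finset.card_erase_add_one ha]
  -- The larger piece `C` satisfies `S.card + 1 ≤ 2 * (C.card + 1)`, so one more node on the path
  -- pays for one factor two.
  have key : ∀ C ⊆ S.erase a, (∃ b ∈ C, r a b) → Linked r C → S.card ≤ 2 * C.card + 1 →
      ∃ l : List α, (∀ x ∈ l, x ∈ S) ∧ l.Nodup ∧ l.IsChain r ∧ l.head? = some a ∧
        S.card + 1 ≤ 2 ^ l.length := by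
    rintro C hC ⟨b, hb, hab⟩ hCl hle
    have hlt : C.card < S.card := (Finset.card_le_card hC).trans_lt (Finset.card_erase_lt_of_mem ha)
    obtain ⟨l, h1, h2, h3, h4, h5⟩ := ih C.card hlt hCl hb (by grind) (hST ha) (by grind)
      (hr _ _ hab) rfl
    refine ⟨a :: l, by grind, List.nodup_cons.2 ⟨by grind, h2⟩, ?_, rfl, ?_⟩
    · rw [List.isChain_cons]
      exact ⟨fun y hy => by rw [h4] at hy; simp at hy; exact hy ▸ hab, h3⟩
    · rw [List.length_cons, pow_succ]
      omega
  by_cases hzero : A.card + B.card = 0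
  · exact ⟨[a], by simpa using ha, by simp, by simp, rfl, by simp [hcard, hzero]⟩
  rcases le_total A.card B.card with h | h
  · rcases hB with rfl | hB
    · simp at h; simp [h] at hzero
    · exact key B (hun ▸ Finset.subset_union_right) hB.2 hB.1 (by omega)
  · rcases hA with rfl | hA
    · simp at h; simp [h] at hzero
    · exact key A (hun ▸ Finset.subset_union_left) hA.2 hA.1 (by omega)

/-- A linked set with at least two elements splits into two linked sets. -/
theorem Linked.exists_partition (hr : ∀ x y, r x y → r y x) {S : Finset α} (hS : Linked r S)
    (hcard : 2 ≤ S.card) :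
    ∃ A B : Finset α, Disjoint A B ∧ A ∪ B = S ∧ Linked r A ∧ Linked r B ∧
      ∃ a ∈ A, ∃ b ∈ B, r a b := by
  classical
  obtain ⟨z, hz⟩ := Finset.card_pos.1 (by omega : 0 < S.card)
  obtain ⟨A, hA, hmax⟩ := Finset.exists_max_image
    (S.powerset.filter fun A => A.Nonempty ∧ A ≠ S ∧ Linked r A) Finset.card
    ⟨{z}, by
      simp only [Finset.mem_filter, Finset.mem_powerset, Finset.singleton_subset_iff]
      refine ⟨hz, by simp, ?_, linked_singleton z⟩
      rintro rfl
      simp at hcard⟩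
  simp only [Finset.mem_filter, Finset.mem_powerset] at hA hmax
  obtain ⟨hAS, hAne, hneS, hAl⟩ := hA
  obtain ⟨a, ha, b, hb, hab⟩ := hS A hAS hAne hneS
  -- A largest proper linked subset lacks just one element: otherwise adding a neighbour would give
  -- a larger one.
  have hins : insert b A = S := by
    by_contra h
    have := hmax (insert b A) ⟨by grind, by simp, h, hAl.insert_of_rel hr ha hab⟩
    rw [Finset.card_insert_of_notMem (by grind)] at this
    omega
  exact ⟨A, {b}, by simp; grind, by rw [← hins]; grind, hAl, linked_singleton b, a, ha, b, by simp,
    hab⟩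

/-- A linked set of maximal degree three splits into two linked sets of comparable sizes. -/
theorem Linked.exists_balanced_partition (hr : ∀ x y, r x y → r y x) {S : Finset α}
    (hS : Linked r S) (hcard : 2 ≤ S.card)
    (hdeg : ∀ x ∈ S, ∀ N ⊆ S, (∀ y ∈ N, r x y) → N.card ≤ 3) :
    ∃ A B : Finset α, Disjoint A B ∧ A ∪ B = S ∧ Linked r A ∧ Linked r B ∧
      (∃ a ∈ A, ∃ b ∈ B, r a b) ∧ B.card ≤ A.card ∧ A.card ≤ 2 * B.card + 1 := by
  classical
  -- The partition is chosen with its larger part as small as possible.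
  have hex : ∃ k, ∃ A B : Finset α, Disjoint A B ∧ A ∪ B = S ∧ Linked r A ∧ Linked r B ∧
      (∃ a ∈ A, ∃ b ∈ B, r a b) ∧ B.card ≤ A.card ∧ A.card = k := by
    obtain ⟨A, B, h1, h2, h3, h4, a, ha, b, hb, hab⟩ := hS.exists_partition hr hcard
    rcases le_total B.card A.card with h | h
    · exact ⟨_, A, B, h1, h2, h3, h4, ⟨a, ha, b, hb, hab⟩, h, rfl⟩
    · exact ⟨_, B, A, h1.symm, by rw [Finset.union_comm, h2], h4, h3,
        ⟨b, hb, a, ha, hr _ _ hab⟩, h, rfl⟩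
  obtain ⟨A, B, hAB, hun, hA, hB, ⟨a, ha, b, hb, hab⟩, hle, hk⟩ := Nat.find_spec hex
  refine ⟨A, B, hAB, hun, hA, hB, ⟨a, ha, b, hb, hab⟩, hle, ?_⟩
  by_contra! hlt
  have hAS : A ⊆ S := hun ▸ Finset.subset_union_left
  have hBS : B ⊆ S := hun ▸ Finset.subset_union_right
  have hdisj := Finset.disjoint_left.1 hAB
  -- If `A` were too large, `a` and the smaller piece `D` could move over to `B`. Both `C` and the
  -- enlarged `B` would then be smaller than `A`, against minimality.
  have key : ∀ C D : Finset α, Disjoint C D → C ∪ D = A.erase a → Linked r C → (∃ c ∈ C, r a c) →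
      (D = ∅ ∨ Linked r D ∧ ∃ d ∈ D, r a d) → D.card ≤ C.card → False := by
    rintro C D hCD hunCD hC ⟨c, hc, hac⟩ hD hDC
    have hcA : A.card = C.card + D.card + 1 := by
      rw [← Finset.card_union_of_disjoint hCD, hunCD, Finset.card_erase_add_one ha]
    have hmem : ∀ x, x ∈ C ∨ x ∈ D ↔ x ≠ a ∧ x ∈ A := fun x => by
      rw [← Finset.mem_union, hunCD, Finset.mem_erase]
    have hCD' := Finset.disjoint_left.1 hCD
    have hBa : Linked r (insert a B) := hB.insert_of_rel hr hb (hr _ _ hab)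
    have hE : Linked r (insert a B ∪ D) := by
      rcases hD with rfl | ⟨hD, d, hd, had⟩
      · simpa using hBa
      · exact hBa.union hr hD (Finset.mem_insert_self a B) hd had
    have hEcard : (insert a B ∪ D).card = B.card + 1 + D.card := by
      rw [Finset.card_union_of_disjoint, Finset.card_insert_of_notMem (by grind)]
      rw [Finset.disjoint_left]
      grind
    have hdis : Disjoint C (insert a B ∪ D) := by
      rw [Finset.disjoint_left]
      grind
    have hunE : C ∪ (insert a B ∪ D) = S := by
      rw [← hun]
      ext x
      have := hmem x
      grind
    rcases le_total (insert a B ∪ D).card C.card with h | h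
    · exact Nat.find_min hex (m := C.card) (by omega) ⟨C, insert a B ∪ D, hdis, hunE, hC, hE,
        ⟨c, hc, a, by simp, hr _ _ hac⟩, h, rfl⟩
    · exact Nat.find_min hex (m := (insert a B ∪ D).card) (by omega) ⟨insert a B ∪ D, C, hdis.symm,
        by rw [Finset.union_comm, hunE], hE, hC, ⟨a, by simp, c, hc, hac⟩, h, rfl⟩
  obtain ⟨C, D, hCD, hunCD, hC, hD⟩ := hA.exists_split hr ha (fun N hN hN' _ => by
    have h := hdeg a (hAS ha) (insert b N) (by grind) (by grind)
    rw [Finset.card_insert_of_notMem (by grind)] at h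
    omega)
  have hcA : A.card = C.card + D.card + 1 := by
    rw [← Finset.card_union_of_disjoint hCD, hunCD, Finset.card_erase_add_one ha]
  rcases le_total D.card C.card with h | h
  · rcases hC with rfl | hC
    · rw [Finset.card_empty] at h hcA
      omega
    · exact key C D hCD hunCD hC.1 hC.2 hD h
  · rcases hD with rfl | hD
    · rw [Finset.card_empty] at h hcA
      omega
    · exact key D C hCD.symm (by rw [Finset.union_comm, hunCD]) hD.1 hD.2 hC h

/-- A linked set of `n` elements and maximal degree three contains a path of length about
`2 * log₂ n`. -/
theorem Linked.exists_long_path (hr : ∀ x y, r x y → r y x) {S : Finset α} (hS : Linked r S)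
    (hne : S.Nonempty) (hdeg : ∀ x ∈ S, ∀ N ⊆ S, (∀ y ∈ N, r x y) → N.card ≤ 3) :
    ∃ l : List α, l ≠ [] ∧ (∀ x ∈ l, x ∈ S) ∧ l.Nodup ∧ l.IsChain r ∧
      S.card ^ 2 ≤ 2 ^ (l.length + 3) := by
  by_cases hcard : 2 ≤ S.card
  · obtain ⟨A, B, hAB, hun, hA, hB, ⟨a, ha, b, hb, hab⟩, h1, h2⟩ :=
      hS.exists_balanced_partition hr hcard hdeg
    have hAS : A ⊆ S := hun ▸ Finset.subset_union_left
    have hBS : B ⊆ S := hun ▸ Finset.subset_union_right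
    have hdisj := Finset.disjoint_left.1 hAB
    obtain ⟨l₁, p1, p2, p3, p4, p5⟩ :=
      hA.exists_path hr ha hAS hdeg (hBS hb) (by grind) hab
    obtain ⟨l₂, q1, q2, q3, q4, q5⟩ :=
      hB.exists_path hr hb hBS hdeg (hAS ha) (by grind) (hr _ _ hab)
    refine ⟨l₁.reverse ++ l₂, ?_, ?_, ?_, ?_, ?_⟩
    · rintro h
      simp at h
      simp [h] at p4
    · grind
    · rw [List.nodup_append]
      refine ⟨List.nodup_reverse.2 p2, q2, ?_⟩
      grind
    · rw [List.isChain_append]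
      refine ⟨?_, q3, ?_⟩
      · rw [List.isChain_reverse]
        exact p3.imp fun x y h => hr _ _ h
      · rw [List.getLast?_reverse, p4, q4]
        rintro x hx y hy
        simp at hx hy
        subst hx hy
        exact hab
    · have hc : S.card = A.card + B.card := by
        rw [← hun, Finset.card_union_of_disjoint hAB]
      rw [List.length_append, List.length_reverse]
      calc S.card ^ 2 = S.card * S.card := sq _
        -- The sum of the two sizes is at most `2 * A.card` and at most `3 * B.card + 1`; this is
        -- where the balance enters.
        _ ≤ (2 * 2 ^ l₁.length) * (4 * 2 ^ l₂.length) := Nat.mul_le_mul (by omega) (by omega)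
        _ = 2 ^ (l₁.length + l₂.length + 3) := by ring
  · obtain ⟨a, ha⟩ := hne
    have h1 : S.card = 1 := by
      have := Finset.card_pos.2 ⟨a, ha⟩
      omega
    exact ⟨[a], by simp, by simpa using ha, by simp, by simp, by simp [h1]⟩

end Linked

/-! ### Barycentric weights as finitely supported functions -/

section Weights

variable {E : Type*}

/-- The sum of a family of weights. -/
noncomputable abbrev total : (E →₀ ℝ) →ₗ[ℝ] ℝ := Finsupp.linearCombination ℝ fun _ => 1

theorem total_eq_sum {s : Finset E} {w : E →₀ ℝ} (hw : w.support ⊆ s) :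
    total w = ∑ y ∈ s, w y := by
  rw [total, Finsupp.linearCombination_apply, Finsupp.sum_of_support_subset w hw _ (by simp)]
  simp

/-- The weights in terms of `a` and `b` instead of their midpoint `m`. -/
noncomputable def spread (a b m : E) (w : E →₀ ℝ) : E →₀ ℝ :=
  w + w m • (Finsupp.single a (1 / 2) + Finsupp.single b (1 / 2) - Finsupp.single m 1)

theorem total_spread (a b m : E) (w : E →₀ ℝ) : total (spread a b m w) = total w := by
  rw [spread, map_add, map_smul, map_sub, map_add]
  simp only [Finsupp.linearCombination_single]
  norm_num

theorem spread_apply {a b m : E} (w : E →₀ ℝ) {y : E} (ha : y ≠ a) (hb : y ≠ b) (hm : y ≠ m) :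
    spread a b m w y = w y := by
  simp [spread, ha.symm, hb.symm, hm.symm]

theorem spread_left {a b m : E} (w : E →₀ ℝ) (hab : a ≠ b) (hma : m ≠ a) :
    spread a b m w a = w a + w m / 2 := by
  simp [spread, hab.symm, hma]
  ring

theorem spread_right {a b m : E} (w : E →₀ ℝ) (hab : a ≠ b) (hmb : m ≠ b) :
    spread a b m w b = w b + w m / 2 := by
  simp [spread, hab, hmb]
  ring

theorem spread_mid {a b m : E} (w : E →₀ ℝ) (hma : m ≠ a) (hmb : m ≠ b) :
    spread a b m w m = 0 := by
  simp [spread, hma.symm, hmb.symm]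

variable [AddCommGroup E] [Module ℝ E]

/-- The weighted sum of points given by a family of weights. -/
noncomputable abbrev bary : (E →₀ ℝ) →ₗ[ℝ] E := Finsupp.linearCombination ℝ id

theorem bary_eq_sum {s : Finset E} {w : E →₀ ℝ} (hw : w.support ⊆ s) :
    bary w = ∑ y ∈ s, w y • y := by
  rw [bary, Finsupp.linearCombination_apply, Finsupp.sum_of_support_subset w hw _ (by simp)]
  rfl

/-- `w` is a family of convex weights on `s` that represents `x`. -/
structure Represents (s : Finset E) (w : E →₀ ℝ) (x : E) : Prop where
  support : w.support ⊆ s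
  nonneg : ∀ y, 0 ≤ w y
  total : total w = 1
  bary : bary w = x

theorem Represents.apply_eq_zero {s : Finset E} {w : E →₀ ℝ} {x y : E} (h : Represents s w x)
    (hy : y ∉ s) : w y = 0 :=
  Finsupp.notMem_support_iff.1 fun h' => hy (h.support h')

theorem Represents.mono {s t : Finset E} {w : E →₀ ℝ} {x : E} (h : Represents s w x)
    (hst : s ⊆ t) : Represents t w x :=
  ⟨h.support.trans hst, h.nonneg, h.total, h.bary⟩

theorem mem_convexHull_iff_represents {s : Finset E} {x : E} :
    x ∈ convexHull ℝ (s : Set E) ↔ ∃ w, Represents s w x := by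
  classical
  rw [Finset.mem_convexHull']
  constructor
  · rintro ⟨w, h0, h1, hx⟩
    have hs : (Finsupp.indicator s fun y _ => w y).support ⊆ s :=
      Finsupp.support_indicator_subset _ _
    refine ⟨Finsupp.indicator s fun y _ => w y, hs, ?_, ?_, ?_⟩
    · intro y
      rw [Finsupp.indicator_apply]
      split_ifs with hy
      · exact h0 y hy
      · exact le_rfl
    · rw [total_eq_sum hs, ← h1]
      exact Finset.sum_congr rfl fun y hy => by simp [hy]
    · rw [bary_eq_sum hs, ← hx]
      exact Finset.sum_congr rfl fun y hy => by simp [hy]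
  · rintro ⟨w, h⟩
    exact ⟨w, fun y _ => h.nonneg y, by rw [← total_eq_sum h.support, h.total],
      by rw [← bary_eq_sum h.support, h.bary]⟩

/-- Weights live on all of `E` instead of on `s`, so that weights on different faces can be compared
and subtracted. -/
theorem affineIndependent_iff_weights {s : Finset E} :
    AffineIndependent ℝ ((↑) : s → E) ↔
      ∀ w : E →₀ ℝ, w.support ⊆ s → total w = 0 → bary w = 0 → w = 0 := by
  classical
  rw [affineIndependent_iff]
  constructor
  · intro h w hw h0 h1
    rw [total_eq_sum hw] at h0
    rw [bary_eq_sum hw] at h1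
    have := h Finset.univ (fun y => w y) (by rw [← h0, ← Finset.sum_coe_sort s])
      (by rw [← h1, ← Finset.sum_coe_sort s])
    ext y
    by_cases hy : y ∈ s
    · exact this ⟨y, hy⟩ (Finset.mem_univ _)
    · exact Finsupp.notMem_support_iff.1 fun h' => hy (hw h')
  · intro h u w h0 h1 y hy
    let v : s →₀ ℝ := Finsupp.indicator u fun y _ => w y
    have hv : v.support ⊆ u := Finsupp.support_indicator_subset _ _
    have h2 := h (v.mapDomain (↑)) (Finsupp.mapDomain_support.trans (by grind)) (by
      rw [Finsupp.linearCombination_mapDomain, Finsupp.linearCombination_apply,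
        Finsupp.sum_of_support_subset v hv _ (by simp), ← h0]
      exact Finset.sum_congr rfl fun y hy => by simp [v, hy]) (by
      rw [Finsupp.linearCombination_mapDomain, Finsupp.linearCombination_apply,
        Finsupp.sum_of_support_subset v hv _ (by simp), ← h1]
      exact Finset.sum_congr rfl fun y hy => by simp [v, hy])
    have h3 : v.mapDomain (↑) (y : E) = v y :=
      Finsupp.mapDomain_apply Subtype.val_injective v y
    rw [h2] at h3
    simpa [v, hy] using h3.symm

/-- A point of two faces lies in the hull of their common vertices. By affine independence, its
weights on either face agree with those on the common vertices. -/
theorem eq_of_represents {L : Geometry.SimplicialComplex ℝ E} {s t : Finset E} (hs : s ∈ L.faces)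
    (ht : t ∈ L.faces) {w v : E →₀ ℝ} {x : E} (hw : Represents s w x) (hv : Represents t v x) :
    w = v := by
  classical
  have hx := L.inter_subset_convexHull hs ht
    ⟨mem_convexHull_iff_represents.2 ⟨w, hw⟩, mem_convexHull_iff_represents.2 ⟨v, hv⟩⟩
  rw [← Finset.coe_inter] at hx
  obtain ⟨u, hu⟩ := mem_convexHull_iff_represents.1 hx
  have key : ∀ r ∈ L.faces, s ∩ t ⊆ r → ∀ w, Represents r w x → w = u := by
    intro r hr hsub w hw
    have hu' := hu.mono hsub
    refine sub_eq_zero.1 (affineIndependent_iff_weights.1 (L.indep hr) (w - u)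
      (Finsupp.support_sub.trans (Finset.union_subset hw.support hu'.support)) ?_ ?_)
    · rw [map_sub, hw.total, hu.total, sub_self]
    · rw [map_sub, hw.bary, hu.bary, sub_self]
  rw [key s hs Finset.inter_subset_left w hw, key t ht Finset.inter_subset_right v hv]

end Weights

/-! ### Bisecting an edge of a simplicial complex -/

section Bisect

variable {E : Type*} [AddCommGroup E] [Module ℝ E]

theorem bary_spread {a b m : E} (hm : m = midpoint ℝ a b) (w : E →₀ ℝ) :
    bary (spread a b m w) = bary w := by
  rw [spread, map_add, map_smul, map_sub, map_add]
  simp only [Finsupp.linearCombination_single, id, hm, midpoint_eq_smul_add]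
  simp

/-- The faces of the complex in which the edge with ends `a` and `b` is bisected at `m`. -/
def bisectFaces [DecidableEq E] (L : Geometry.SimplicialComplex ℝ E) (a b m : E) :
    Set (Finset E) :=
  {s | (s ∈ L.faces ∧ ¬ (a ∈ s ∧ b ∈ s)) ∨
    ∃ u ∈ L.faces, a ∈ u ∧ b ∈ u ∧ ∃ x ⊆ u, ¬ (a ∈ x ∧ b ∈ x) ∧ s = insert m x}

variable [DecidableEq E] {L : Geometry.SimplicialComplex ℝ E} {a b m : E}

theorem midpoint_notMem_face (hab : a ≠ b) (he : {a, b} ∈ L.faces) (hm : m = midpoint ℝ a b)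
    {s : Finset E} (hs : s ∈ L.faces) : m ∉ s := by
  intro h
  have hv : m ∈ L.vertices := L.down_closed hs (Finset.singleton_subset_iff.2 h) (by simp)
  have hmem : m ∈ convexHull ℝ (({a, b} : Finset E) : Set E) := by
    rw [Finset.coe_pair, convexHull_pair, hm]
    exact midpoint_mem_segment a b
  have := (Geometry.SimplicialComplex.vertex_mem_convexHull_iff hv he).1 hmem
  rw [Finset.mem_insert, Finset.mem_singleton, hm] at this
  rcases this with h | h
  · exact hab ((midpoint_eq_left_iff ℝ).1 h)
  · exact hab ((midpoint_eq_right_iff ℝ).1 h)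

/-- This makes `spread` invertible on nonnegative weights of new faces: one of the weights at `a`
and `b` vanishes, so the weight at `m` is twice the smaller of the two spread weights. -/
theorem not_ends_mem_of_mem_bisectFaces (hma : m ≠ a) (hmb : m ≠ b) {s : Finset E}
    (hs : s ∈ bisectFaces L a b m) : a ∉ s ∨ b ∉ s := by
  rcases hs with ⟨-, h⟩ | ⟨u, -, -, -, x, -, h, rfl⟩ <;> grind

/-- Through `spread`, weights on a new face become weights on an old one, where independence and
uniqueness of weights are known. -/
theorem exists_parent_of_mem_bisectFaces (hab : a ≠ b) (he : {a, b} ∈ L.faces)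
    (hm : m = midpoint ℝ a b) {s : Finset E} (hs : s ∈ bisectFaces L a b m) :
    ∃ u ∈ L.faces, ∀ w : E →₀ ℝ, w.support ⊆ s → (spread a b m w).support ⊆ u := by
  have hme := midpoint_notMem_face hab he hm he
  have hma : m ≠ a := by grind
  have hmb : m ≠ b := by grind
  rcases hs with ⟨hs, -⟩ | ⟨u, hu, ha, hb, x, hx, -, rfl⟩
  · refine ⟨s, hs, fun w hw => ?_⟩
    have : w m = 0 :=
      Finsupp.notMem_support_iff.1 fun h => midpoint_notMem_face hab he hm hs (hw h)
    simpa [spread, this] using hw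
  · refine ⟨u, hu, fun w hw y hy => ?_⟩
    by_contra hyu
    have hya : y ≠ a := by grind
    have hyb : y ≠ b := by grind
    rw [Finsupp.mem_support_iff] at hy
    by_cases hym : y = m
    · rw [hym] at hy
      exact hy (spread_mid w hma hmb)
    · rw [spread_apply w hya hyb hym, ← Finsupp.mem_support_iff] at hy
      have := hw hy
      grind

/-- The complex in which the edge with ends `a` and `b` is bisected at its midpoint `m`. -/
def bisect (L : Geometry.SimplicialComplex ℝ E) (a b m : E) (hab : a ≠ b) (he : {a, b} ∈ L.faces)
    (hm : m = midpoint ℝ a b) : Geometry.SimplicialComplex ℝ E where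
  faces := bisectFaces L a b m
  isRelLowerSet_faces := by
    rintro s hs
    refine ⟨?_, fun t hts ht => ?_⟩
    · rcases hs with ⟨hs, -⟩ | ⟨u, hu, ha, hb, x, hx, -, rfl⟩
      · exact L.nonempty_of_mem_faces hs
      · simp
    · have hts : t ⊆ s := hts
      rcases hs with ⟨hs, h⟩ | ⟨u, hu, ha, hb, x, hx, h, rfl⟩
      · exact Or.inl ⟨L.down_closed hs hts ht, by grind⟩
      · by_cases hmt : m ∈ t
        · exact Or.inr ⟨u, hu, ha, hb, t.erase m, by grind, by grind, by grind⟩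
        · exact Or.inl ⟨L.down_closed hu (by grind) ht, by grind⟩
  indep := by
    intro s hs
    have hme := midpoint_notMem_face hab he hm he
    have hma : m ≠ a := by grind
    have hmb : m ≠ b := by grind
    obtain ⟨u, hu, hsupp⟩ := exists_parent_of_mem_bisectFaces hab he hm hs
    rw [affineIndependent_iff_weights]
    intro w hw h0 h1
    have hz : spread a b m w = 0 := affineIndependent_iff_weights.1 (L.indep hu) _ (hsupp w hw)
      (by rw [total_spread, h0]) (by rw [bary_spread hm, h1])
    have hza := spread_left w hab hma
    have hzb := spread_right w hab hmb
    rw [hz, Finsupp.zero_apply] at hza hzb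
    have hor : w a = 0 ∨ w b = 0 := (not_ends_mem_of_mem_bisectFaces hma hmb hs).imp
      (fun h => Finsupp.notMem_support_iff.1 fun h' => h (hw h'))
      (fun h => Finsupp.notMem_support_iff.1 fun h' => h (hw h'))
    have hwm : w m = 0 := by rcases hor with h | h <;> linarith
    rw [← hz, spread, hwm, zero_smul, add_zero]
  inter_subset_convexHull := by
    rintro s t hs ht x ⟨hxs, hxt⟩
    have hme := midpoint_notMem_face hab he hm he
    have hma : m ≠ a := by grind
    have hmb : m ≠ b := by grind
    obtain ⟨w, hw⟩ := mem_convexHull_iff_represents.1 hxs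
    obtain ⟨v, hv⟩ := mem_convexHull_iff_represents.1 hxt
    have key : ∀ r ∈ bisectFaces L a b m, ∀ w, Represents r w x →
        (∃ u ∈ L.faces, Represents u (spread a b m w) x) ∧ (w a = 0 ∨ w b = 0) := by
      intro r hr w hw
      obtain ⟨u, hu, hsupp⟩ := exists_parent_of_mem_bisectFaces hab he hm hr
      refine ⟨⟨u, hu, hsupp w hw.support, fun y => ?_, by rw [total_spread, hw.total],
        by rw [bary_spread hm, hw.bary]⟩, (not_ends_mem_of_mem_bisectFaces hma hmb hr).imp
          hw.apply_eq_zero hw.apply_eq_zero⟩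
      have := hw.nonneg m
      have := hw.nonneg y
      by_cases hya : y = a
      · subst hya
        rw [spread_left w hab hma]
        linarith
      by_cases hyb : y = b
      · subst hyb
        rw [spread_right w hab hmb]
        linarith
      by_cases hym : y = m
      · rw [hym, spread_mid w hma hmb]
      · rwa [spread_apply w hya hyb hym]
    obtain ⟨⟨u, hu, hwu⟩, hw0⟩ := key s hs w hw
    obtain ⟨⟨u', hu', hvu⟩, hv0⟩ := key t ht v hv
    have heq : spread a b m w = spread a b m v := eq_of_represents hu hu' hwu hvu
    have ha := DFunLike.congr_fun heq a
    have hb := DFunLike.congr_fun heq b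
    rw [spread_left _ hab hma, spread_left _ hab hma] at ha
    rw [spread_right _ hab hmb, spread_right _ hab hmb] at hb
    -- Equal spread weights, together with a vanishing weight at `a` or `b` on each side, determine
    -- the weight at `m`.
    have hwm : w m = v m := by
      have := hw.nonneg a
      have := hw.nonneg b
      have := hv.nonneg a
      have := hv.nonneg b
      rcases hw0 with h | h <;> rcases hv0 with h' | h' <;> linarith
    have hwv : w = v := by
      rw [spread, spread, hwm] at heq
      exact add_right_cancel heq
    rw [← Finset.coe_inter]
    exact mem_convexHull_iff_represents.2
      ⟨w, Finset.subset_inter hw.support (hwv ▸ hv.support), hw.nonneg, hw.total, hw.bary⟩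

variable (hab : a ≠ b) (he : {a, b} ∈ L.faces) (hm : m = midpoint ℝ a b)

theorem bisect_refines {s : Finset E} (hs : s ∈ (bisect L a b m hab he hm).faces) :
    ∃ t ∈ L.faces, convexHull ℝ (s : Set E) ⊆ convexHull ℝ (t : Set E) := by
  rcases hs with ⟨hs, -⟩ | ⟨u, hu, ha, hb, x, hx, -, rfl⟩
  · exact ⟨s, hs, subset_rfl⟩
  · refine ⟨u, hu, convexHull_min ?_ (convex_convexHull ℝ _)⟩
    rw [Finset.coe_insert, Set.insert_subset_iff]
    refine ⟨?_, (Finset.coe_subset.2 hx).trans (subset_convexHull ℝ _)⟩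
    rw [hm]
    exact (convex_convexHull ℝ _).midpoint_mem (subset_convexHull ℝ _ ha)
      (subset_convexHull ℝ _ hb)

/-- A point of a simplex with the edge from `a` to `b`, not closer to `b` than to `a`, lies in the
half of the simplex at `a`. -/
theorem mem_convexHull_insert_erase {u : Finset E} (ha : a ∈ u) (hb : b ∈ u) (hab : a ≠ b)
    (hm : m = midpoint ℝ a b) {w : E →₀ ℝ} {x : E} (hw : Represents u w x) (hle : w b ≤ w a) :
    x ∈ convexHull ℝ ((insert m (u.erase b) : Finset E) : Set E) := by
  -- The weight `w b` at `b` and an equal amount at `a` are moved to the midpoint. This empties `b`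
  -- and leaves `w a - w b ≥ 0` at `a`.
  have hx : x = bary (w + (2 * w b) • (Finsupp.single m 1 -
      (Finsupp.single a (1 / 2) + Finsupp.single b (1 / 2)))) := by
    rw [map_add, map_smul, map_sub, map_add, hw.bary]
    simp only [Finsupp.linearCombination_single, id, hm, midpoint_eq_smul_add]
    simp
  have ht : total (w + (2 * w b) • (Finsupp.single m 1 -
      (Finsupp.single a (1 / 2) + Finsupp.single b (1 / 2)))) = 1 := by
    rw [map_add, map_smul, map_sub, map_add, hw.total]
    simp only [Finsupp.linearCombination_single]
    norm_num
  have hma : m ≠ a := fun h => hab ((midpoint_eq_left_iff ℝ).1 (hm ▸ h))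
  have hmb : m ≠ b := fun h => hab ((midpoint_eq_right_iff ℝ).1 (hm ▸ h))
  have h0 := hw.nonneg b
  refine mem_convexHull_iff_represents.2 ⟨_, fun y hy => ?_, fun y => ?_, ht, hx.symm⟩
  · by_contra hyu
    have hya : y ≠ a := by grind
    have hym : y ≠ m := by grind
    rw [Finsupp.mem_support_iff] at hy
    by_cases hyb : y = b
    · subst hyb
      simp [hab, hmb] at hy
      apply hy
      ring
    · have : w y = 0 := hw.apply_eq_zero (by grind)
      simp [hya.symm, hym.symm, Ne.symm hyb, this] at hy
  · have hy0 := hw.nonneg y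
    by_cases hyb : y = b
    · subst hyb
      simp [hab, hmb]
      linarith
    by_cases hya : y = a
    · subst hya
      simp [hyb, hma]
      linarith
    by_cases hym : y = m
    · subst hym
      simp [Ne.symm hya, Ne.symm hyb]
      linarith
    · simp [Ne.symm hya, Ne.symm hyb, Ne.symm hym, hy0]

theorem bisect_space : (bisect L a b m hab he hm).space = L.space := by
  ext x
  simp only [Geometry.SimplicialComplex.mem_space_iff]
  constructor
  · rintro ⟨s, hs, hx⟩
    obtain ⟨t, ht, hst⟩ := bisect_refines hab he hm hs
    exact ⟨t, ht, hst hx⟩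
  · rintro ⟨u, hu, hx⟩
    by_cases h : a ∈ u ∧ b ∈ u
    · obtain ⟨w, hw⟩ := mem_convexHull_iff_represents.1 hx
      rcases le_total (w b) (w a) with hle | hle
      · exact ⟨_, Or.inr ⟨u, hu, h.1, h.2, _, Finset.erase_subset b u, by simp, rfl⟩,
          mem_convexHull_insert_erase h.1 h.2 hab hm hw hle⟩
      · exact ⟨_, Or.inr ⟨u, hu, h.1, h.2, _, Finset.erase_subset a u, by simp, rfl⟩,
          mem_convexHull_insert_erase h.2 h.1 hab.symm (by rw [hm, midpoint_comm]) hw hle⟩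
    · exact ⟨u, Or.inl ⟨hu, h⟩, hx⟩

theorem bisect_vertices {x : E} (hx : x ∈ (bisect L a b m hab he hm).vertices) :
    x ∈ L.vertices ∨ x = m := by
  rcases hx with ⟨hx, -⟩ | ⟨u, hu, ha, hb, y, hy, -, h⟩
  · exact Or.inl hx
  · right
    have : m ∈ ({x} : Finset E) := h ▸ Finset.mem_insert_self m y
    exact (Finset.mem_singleton.1 this).symm

end Bisect

/-! ### Bisection preserves triangulated models -/

section Model

variable {E : Type*} [AddCommGroup E] [Module ℝ E] {K L : Geometry.SimplicialComplex ℝ E}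

/-- The triangleFaces of a complex in a real vector space. -/
def triangleFaces (L : Geometry.SimplicialComplex ℝ E) : Set (Finset E) :=
  {t | t ∈ L.faces ∧ t.card = 3}

/-- A triangulated model in a real vector space. -/
structure IsTriangulated (L : Geometry.SimplicialComplex ℝ E) : Prop where
  finite : L.faces.Finite
  pure : ∀ s ∈ L.faces, ∃ t ∈ triangleFaces L, s ⊆ t
  edge_le_two : ∀ e ∈ L.faces, e.card = 2 → {t | t ∈ triangleFaces L ∧ e ⊆ t}.encard ≤ 2

/-- Two different finite sets with two elements in common. -/
def HasCommonEdge {α : Type*} (s t : Finset α) : Prop :=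
  s ≠ t ∧ ∃ e : Finset α, e.card = 2 ∧ e ⊆ s ∧ e ⊆ t

theorem HasCommonEdge.symm {α : Type*} {s t : Finset α} (h : HasCommonEdge s t) :
    HasCommonEdge t s :=
  ⟨h.1.symm, h.2.imp fun _ he => ⟨he.1, he.2.2, he.2.1⟩⟩

theorem IsTriangulated.card_le_three (hL : IsTriangulated L) {s : Finset E} (hs : s ∈ L.faces) :
    s.card ≤ 3 := by
  obtain ⟨t, ht, hst⟩ := hL.pure s hs
  exact (Finset.card_le_card hst).trans ht.2.le

theorem IsTriangulated.not_three (hL : IsTriangulated L) {e x y z : Finset E} (he : e.card = 2)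
    (hx : x ∈ triangleFaces L) (hy : y ∈ triangleFaces L) (hz : z ∈ triangleFaces L) (hex : e ⊆ x)
    (hey : e ⊆ y) (hez : e ⊆ z) (hxy : x ≠ y) (hxz : x ≠ z) (hyz : y ≠ z) : False := by
  have hne : e.Nonempty := Finset.card_pos.1 (by omega)
  have h := hL.edge_le_two e (L.down_closed hx.1 hex hne) he
  have h3 : ({x, y, z} : Set (Finset E)).encard = 3 := Set.encard_eq_three.2
    ⟨x, y, z, hxy, hxz, hyz, rfl⟩
  have hle := (Set.encard_le_encard (s := {x, y, z}) (by
    rintro u (rfl | rfl | rfl)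
    exacts [⟨hx, hex⟩, ⟨hy, hey⟩, ⟨hz, hez⟩])).trans h
  rw [h3] at hle
  exact absurd hle (by decide)

variable [DecidableEq E] {a b m : E}

/-- A triangle has at most three neighbours. -/
theorem IsTriangulated.card_neighbours_le (hL : IsTriangulated L) {s : Finset E} (hs : s ∈ triangleFaces L)
    {N : Finset (Finset E)} (hN : ∀ t ∈ N, t ∈ triangleFaces L) (hsN : ∀ t ∈ N, HasCommonEdge s t) :
    N.card ≤ 3 := by
  have hcard : ∀ t ∈ N, (s ∩ t).card = 2 := by
    intro t ht
    obtain ⟨hne, e, he, hes, het⟩ := hsN t ht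
    have h1 := Finset.card_le_card (Finset.subset_inter hes het)
    have h2 : (s ∩ t).card < 3 := by
      by_contra! h
      have h3 := Finset.eq_of_subset_of_card_le (Finset.inter_subset_left (s₁ := s) (s₂ := t))
        (by rw [hs.2]; exact h)
      have h4 := Finset.eq_of_subset_of_card_le (Finset.inter_subset_right (s₁ := s) (s₂ := t))
        (by rw [(hN t ht).2]; exact h)
      exact hne (h3.symm.trans h4)
    omega
  have h3 : (s.powersetCard 2).card = 3 := by
    rw [Finset.card_powersetCard, hs.2]
    rfl
  rw [← h3]
  -- Neighbours are counted by the sides of `s`: two neighbours at the same side would put three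
  -- triangles on that edge.
  refine Finset.card_le_card_of_injOn (fun t => s ∩ t) (fun t ht => ?_) ?_
  · exact Finset.mem_powersetCard.2 ⟨Finset.inter_subset_left, hcard t ht⟩
  · intro t ht u hu htu
    simp only at htu
    by_contra hne
    exact hL.not_three (hcard t ht) hs (hN t ht) (hN u hu) Finset.inter_subset_left
      Finset.inter_subset_right (htu ▸ Finset.inter_subset_right) (hsN t ht).1 (hsN u hu).1 hne

theorem mem_triangleFaces_bisect (hL : IsTriangulated L) (hab : a ≠ b)
    (he : {a, b} ∈ L.faces) (hm : m = midpoint ℝ a b) {t : Finset E} :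
    t ∈ triangleFaces (bisect L a b m hab he hm) ↔ (t ∈ triangleFaces L ∧ ¬ (a ∈ t ∧ b ∈ t)) ∨
      ∃ u ∈ triangleFaces L, a ∈ u ∧ b ∈ u ∧ (t = insert m (u.erase a) ∨ t = insert m (u.erase b)) := by
  have hmf := fun s (hs : s ∈ L.faces) => midpoint_notMem_face hab he hm hs
  constructor
  · rintro ⟨h | ⟨u, hu, ha, hb, x, hx, hn, rfl⟩, hc⟩
    · exact Or.inl ⟨⟨h.1, hc⟩, h.2⟩
    · right
      have hmu := hmf u hu
      rw [Finset.card_insert_of_notMem (by grind)] at hc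
      have hu3 := hL.card_le_three hu
      -- Here `x` has two elements and misses the end `z` of the edge, while `u` has at most three
      -- elements.
      have key : ∀ z ∈ u, z ∉ x → u.card = 3 ∧ x = u.erase z := by
        intro z hz hzx
        have hsub : x ⊆ u.erase z := by grind
        have hc1 := Finset.card_erase_of_mem hz
        have hc2 := Finset.card_le_card hsub
        exact ⟨by omega, Finset.eq_of_subset_of_card_le hsub (by omega)⟩
      by_cases hax : a ∈ x
      · obtain ⟨h1, h2⟩ := key b hb (by grind)
        exact ⟨u, ⟨hu, h1⟩, ha, hb, Or.inr (by rw [h2])⟩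
      · obtain ⟨h1, h2⟩ := key a ha hax
        exact ⟨u, ⟨hu, h1⟩, ha, hb, Or.inl (by rw [h2])⟩
  · rintro (⟨h, hn⟩ | ⟨u, hu, ha, hb, h⟩)
    · exact ⟨Or.inl ⟨h.1, hn⟩, h.2⟩
    · have hmu := hmf u hu.1
      have hc : ∀ z ∈ u, (insert m (u.erase z)).card = 3 := by
        intro z hz
        rw [Finset.card_insert_of_notMem (by grind), Finset.card_erase_of_mem hz, hu.2]
      rcases h with rfl | rfl
      · exact ⟨Or.inr ⟨u, hu.1, ha, hb, _, Finset.erase_subset _ _, by simp, rfl⟩, hc a ha⟩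
      · exact ⟨Or.inr ⟨u, hu.1, ha, hb, _, Finset.erase_subset _ _, by simp, rfl⟩, hc b hb⟩

theorem IsTriangulated.bisect_pure (hL : IsTriangulated L) (hab : a ≠ b)
    (he : {a, b} ∈ L.faces) (hm : m = midpoint ℝ a b) {s : Finset E}
    (hs : s ∈ (Strip.bisect L a b m hab he hm).faces) :
    ∃ t ∈ triangleFaces (Strip.bisect L a b m hab he hm), s ⊆ t := by
  have htri := fun t => mem_triangleFaces_bisect hL hab he hm (t := t)
  have key : ∀ x, (∃ u ∈ L.faces, x ⊆ u ∧ a ∈ u ∧ b ∈ u) → ¬ (a ∈ x ∧ b ∈ x) →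
      ∃ t ∈ triangleFaces (Strip.bisect L a b m hab he hm), insert m x ⊆ t := by
    rintro x ⟨u, hu, hxu, ha, hb⟩ hn
    obtain ⟨v, hv, huv⟩ := hL.pure u hu
    by_cases hax : a ∈ x
    · exact ⟨_, (htri _).2 (Or.inr ⟨v, hv, huv ha, huv hb, Or.inr rfl⟩), by grind⟩
    · exact ⟨_, (htri _).2 (Or.inr ⟨v, hv, huv ha, huv hb, Or.inl rfl⟩), by grind⟩
  rcases hs with (⟨hs, hn⟩ | ⟨u, hu, ha, hb, x, hx, hn, rfl⟩)
  · obtain ⟨u, hu, hsu⟩ := hL.pure s hs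
    by_cases h : a ∈ u ∧ b ∈ u
    · obtain ⟨t, ht, hst⟩ := key s ⟨u, hu.1, hsu, h.1, h.2⟩ hn
      exact ⟨t, ht, (Finset.subset_insert m s).trans hst⟩
    · exact ⟨u, (htri u).2 (Or.inl ⟨hu, h⟩), hsu⟩
  · exact key x ⟨u, hu, hx, ha, hb⟩ hn

theorem IsTriangulated.exists_eq_insert_erase (hL : IsTriangulated L) (hab : a ≠ b)
    (he : {a, b} ∈ L.faces) (hm : m = midpoint ℝ a b) {t : Finset E}
    (ht : t ∈ triangleFaces (Strip.bisect L a b m hab he hm)) (hmt : m ∈ t) :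
    ∃ u ∈ triangleFaces L, a ∈ u ∧ b ∈ u ∧ m ∉ u ∧
      (t = insert m (u.erase a) ∨ t = insert m (u.erase b)) := by
  rcases (mem_triangleFaces_bisect hL hab he hm).1 ht with ⟨h, -⟩ | ⟨u, hu, ha, hb, h⟩
  · exact absurd hmt (midpoint_notMem_face hab he hm h.1)
  · exact ⟨u, hu, ha, hb, midpoint_notMem_face hab he hm hu.1, h⟩

/-- Replacing `m` by the other end `q` recovers the parent triangle, so the triangles at a half-edge
inject into those at `{a, b}`. -/
theorem IsTriangulated.bisect_edge_half (hL : IsTriangulated L) (hab : a ≠ b)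
    (he : {a, b} ∈ L.faces) (hm : m = midpoint ℝ a b) {p q : E}
    (hpq : p = a ∧ q = b ∨ p = b ∧ q = a) :
    {t | t ∈ triangleFaces (Strip.bisect L a b m hab he hm) ∧ {m, p} ⊆ t}.encard ≤ 2 := by
  have hmap : ∀ t, t ∈ triangleFaces (Strip.bisect L a b m hab he hm) → {m, p} ⊆ t →
      ∃ u ∈ triangleFaces L, a ∈ u ∧ b ∈ u ∧ t = insert m (u.erase q) ∧
        insert q (t.erase m) = u := by
    intro t ht hft
    obtain ⟨u, hu, ha, hb, hmu, h⟩ :=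
      hL.exists_eq_insert_erase hab he hm ht (hft (Finset.mem_insert_self m {p}))
    have hpt : p ∈ t := hft (by simp)
    clear hm ht hft
    have htu : t = insert m (u.erase q) := by grind
    exact ⟨u, hu, ha, hb, htu, by grind⟩
  refine (Set.encard_le_encard_of_injOn (f := fun t => insert q (t.erase m))
    (t := {t | t ∈ triangleFaces L ∧ {a, b} ⊆ t}) ?_ ?_).trans
    (hL.edge_le_two _ he (Finset.card_pair hab))
  · rintro t ⟨ht, hft⟩
    obtain ⟨u, hu, ha, hb, -, h⟩ := hmap t ht hft
    simp only [Set.mem_ofPred_eq, h]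
    exact ⟨hu, by grind⟩
  · rintro t ⟨ht, hft⟩ t' ⟨ht', hft'⟩ heq
    obtain ⟨u, -, -, -, h1, h2⟩ := hmap t ht hft
    obtain ⟨u', -, -, -, h3, h4⟩ := hmap t' ht' hft'
    simp only [h2, h4] at heq
    rw [h1, h3, heq]

/-- A median belongs only to the two halves of the triangle `{a, b, p}`. -/
theorem IsTriangulated.bisect_edge_median (hL : IsTriangulated L) (hab : a ≠ b)
    (he : {a, b} ∈ L.faces) (hm : m = midpoint ℝ a b) {p : E} (hpm : p ≠ m)
    (hpa : p ≠ a) (hpb : p ≠ b) :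
    {t | t ∈ triangleFaces (Strip.bisect L a b m hab he hm) ∧ {m, p} ⊆ t}.encard ≤ 2 := by
  refine (Set.encard_le_encard (t := {insert m (({a, b, p} : Finset E).erase a),
    insert m (({a, b, p} : Finset E).erase b)}) ?_).trans 
    ((Set.encard_insert_le _ _).trans (by rw [Set.encard_singleton]; norm_num))
  rintro t ⟨ht, hft⟩
  obtain ⟨u, hu, ha, hb, hmu, h⟩ :=
    hL.exists_eq_insert_erase hab he hm ht (hft (Finset.mem_insert_self m {p}))
  have hpt : p ∈ t := hft (by simp)
  have hpu : p ∈ u := by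
    clear hm ht hft
    grind
  have hu' : ({a, b, p} : Finset E) = u := by
    refine Finset.eq_of_subset_of_card_le (by grind) ?_
    rw [hu.2, Finset.card_eq_three.2 ⟨a, b, p, hab, Ne.symm hpa, Ne.symm hpb, rfl⟩]
  rw [hu']
  exact h

/-- An old triangle at `f` either survives or is replaced by its half `insert m f`; sending this
half back to its parent `f ∪ {a, b}` is injective. -/
theorem IsTriangulated.bisect_edge_old (hL : IsTriangulated L) (hab : a ≠ b)
    (he : {a, b} ∈ L.faces) (hm : m = midpoint ℝ a b) {f : Finset E}
    (hf : f ∈ (Strip.bisect L a b m hab he hm).faces) (hf2 : f.card = 2) (hmf' : m ∉ f) :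
    {t | t ∈ triangleFaces (Strip.bisect L a b m hab he hm) ∧ f ⊆ t}.encard ≤ 2 := by
  have hmf := fun s (hs : s ∈ L.faces) => midpoint_notMem_face hab he hm hs
  have htri := fun t => mem_triangleFaces_bisect hL hab he hm (t := t)
  have hfL : f ∈ L.faces := by
    rcases hf with h | ⟨u, -, -, -, x, -, -, rfl⟩
    · exact h.1
    · simp at hmf'
  have hmap : ∀ t, t ∈ triangleFaces (Strip.bisect L a b m hab he hm) → f ⊆ t →
      (m ∉ t ∧ t ∈ triangleFaces L ∧ ¬ (a ∈ t ∧ b ∈ t)) ∨ (t = insert m f ∧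
        f ∪ {a, b} ∈ triangleFaces L) := by
    intro t ht hft
    rcases (htri t).1 ht with ⟨h, hn⟩ | ⟨u, hu, ha, hb, h⟩
    · exact Or.inl ⟨hmf t h.1, h, hn⟩
    · right
      have hz : ∃ z, (z = a ∨ z = b) ∧ t = insert m (u.erase z) := by
        rcases h with h | h
        exacts [⟨a, Or.inl rfl, h⟩, ⟨b, Or.inr rfl, h⟩]
      obtain ⟨z, hz, rfl⟩ := hz
      have hzu : z ∈ u := by grind
      have hfe : f = u.erase z := by
        refine Finset.eq_of_subset_of_card_le (by grind) ?_
        rw [Finset.card_erase_of_mem hzu, hu.2, hf2]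
      refine ⟨by rw [hfe], ?_⟩
      have : f ∪ {a, b} = u := by grind
      rwa [this]
  refine (Set.encard_le_encard_of_injOn (f := fun t => if m ∈ t then f ∪ {a, b} else t)
      (t := {t | t ∈ triangleFaces L ∧ f ⊆ t}) ?_ ?_).trans (hL.edge_le_two _ hfL hf2)
  · rintro t ⟨ht, hft⟩
    rcases hmap t ht hft with ⟨h1, h2, -⟩ | ⟨rfl, h⟩
    · simp only [h1, if_false]
      exact ⟨h2, hft⟩
    · simp only [Finset.mem_insert_self, if_true]
      exact ⟨h, Finset.subset_union_left⟩
  · rintro t ⟨ht, hft⟩ u ⟨hu, hfu⟩ heq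
    simp only at heq
    rcases hmap t ht hft with ⟨h1, h2, h3⟩ | ⟨h1, h2⟩ <;>
      rcases hmap u hu hfu with ⟨k1, k2, k3⟩ | ⟨k1, k2⟩
    · simpa [h1, k1] using heq
    · have : m ∈ u := by simp [k1]
      simp only [h1, this, if_true, if_false] at heq
      exact absurd ⟨by simp [heq], by simp [heq]⟩ h3
    · have : m ∈ t := by simp [h1]
      simp only [k1, this, if_true, if_false] at heq
      exact absurd ⟨by simp [← heq], by simp [← heq]⟩ k3
    · rw [h1, k1]

/-- Bisecting an edge of a triangulated model gives a triangulated model. -/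
theorem IsTriangulated.bisect (hL : IsTriangulated L) (hab : a ≠ b)
    (he : {a, b} ∈ L.faces) (hm : m = midpoint ℝ a b) :
    IsTriangulated (Strip.bisect L a b m hab he hm) where
  finite := by
    refine (hL.finite.union ((hL.finite.insert ∅).image (insert m))).subset ?_
    rintro s (hs | ⟨u, hu, ha, hb, x, hx, hn, rfl⟩)
    · exact Or.inl hs.1
    · refine Or.inr ⟨x, ?_, rfl⟩
      rcases x.eq_empty_or_nonempty with h | h
      · exact Or.inl h
      · exact Or.inr (L.down_closed hu hx h)
  pure s hs := hL.bisect_pure hab he hm hs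
  edge_le_two f hf hf2 := by
    by_cases hmf : m ∈ f
    · obtain ⟨p, hp⟩ := Finset.card_eq_one.1 (by rw [Finset.card_erase_of_mem hmf, hf2] :
        (f.erase m).card = 1)
      have hpm : p ≠ m := Finset.ne_of_mem_erase (hp ▸ Finset.mem_singleton_self p)
      rw [← Finset.insert_erase hmf, hp]
      by_cases hpa : p = a
      · exact hL.bisect_edge_half hab he hm (Or.inl ⟨hpa, rfl⟩)
      by_cases hpb : p = b
      · exact hL.bisect_edge_half hab he hm (Or.inr ⟨hpb, rfl⟩)
      exact hL.bisect_edge_median hab he hm hpm hpa hpb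
    · exact hL.bisect_edge_old hab he hm hf hf2 hmf

end Model

/-! ### Adjacencies between halves of triangles -/

section Halves

variable {E : Type*} [DecidableEq E] {a b m : E}

/-- A triangle with the side of `s` opposite to `z` is a neighbour of the half of `s` at that
side. -/
theorem hasCommonEdge_insert_erase {s p : Finset E} (hs : s.card = 3) {z : E} (hz : z ∈ s)
    (hmp : m ∉ p) (hsub : s.erase z ⊆ p) : HasCommonEdge p (insert m (s.erase z)) :=
  ⟨by grind, s.erase z, by rw [Finset.card_erase_of_mem hz, hs], hsub, Finset.subset_insert _ _⟩

theorem hasCommonEdge_halves {s : Finset E} (hs : s.card = 3) (ha : a ∈ s) (hb : b ∈ s)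
    (hab : a ≠ b) (hms : m ∉ s) : HasCommonEdge (insert m (s.erase a)) (insert m (s.erase b)) := by
  refine ⟨?_, insert m ((s.erase a).erase b), ?_, ?_, ?_⟩
  · intro h
    have : b ∈ insert m (s.erase a) := by grind
    grind
  · rw [Finset.card_insert_of_notMem (by grind), Finset.card_erase_of_mem (by grind),
      Finset.card_erase_of_mem ha, hs]
  · grind
  · grind

theorem hasCommonEdge_across {s t : Finset E} (has : a ∈ s) (hbs : b ∈ s)
    (hat : a ∈ t) (hbt : b ∈ t) (hab : a ≠ b) (hms : m ∉ s) (hmt : m ∉ t) (hst : s ≠ t) :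
    HasCommonEdge (insert m (s.erase b)) (insert m (t.erase b)) := by
  refine ⟨?_, {m, a}, Finset.card_pair (by grind), by grind, by grind⟩
  intro h
  apply hst
  have h1 : s = insert b ((insert m (s.erase b)).erase m) := by grind
  have h2 : t = insert b ((insert m (t.erase b)).erase m) := by grind
  rw [h1, h2, h]

end Halves

/-! ### Absorbing a missing triangle into a strip -/

section PartialStrip

variable {E : Type*} [AddCommGroup E] [Module ℝ E] {L : Geometry.SimplicialComplex ℝ E}

/-- A strip `l` of some of the triangles of `L`, such that a chain of triangles leads out of every
set of the remaining ones. -/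
structure IsPartialStrip (L : Geometry.SimplicialComplex ℝ E) (l : List (Finset E)) : Prop where
  nodup : l.Nodup
  mem : ∀ t ∈ l, t ∈ triangleFaces L
  chain : l.IsChain HasCommonEdge
  attached : ∀ A : Set (Finset E), A.Nonempty → (∀ t ∈ A, t ∈ triangleFaces L ∧ t ∉ l) →
    ∃ t ∈ A, ∃ s ∈ triangleFaces L, s ∉ A ∧ HasCommonEdge t s

variable [DecidableEq E] {a b m : E}

theorem eq_or_eq_of_ends_mem (hL : IsTriangulated L) (hab : a ≠ b) {s t u : Finset E}
    (hs : s ∈ triangleFaces L) (ht : t ∈ triangleFaces L) (hst : s ≠ t) (has : a ∈ s) (hbs : b ∈ s)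
    (hat : a ∈ t) (hbt : b ∈ t) (hu : u ∈ triangleFaces L) (hau : a ∈ u) (hbu : b ∈ u) :
    u = s ∨ u = t := by
  by_contra! h
  exact hL.not_three (Finset.card_pair hab) hs ht hu (by grind) (by grind) (by grind) hst
    h.1.symm h.2.symm

/-- If the strip enters the triangle `s` at the side through `a` and leaves it at the side through
`b`, then bisecting the edge from `a` to `b` lets it pass through the triangle `t` beyond that
edge. -/
theorem IsPartialStrip.bisect_of_oriented (hL : IsTriangulated L) {l₁ l₂ : List (Finset E)}
    {s t : Finset E} (hl : IsPartialStrip L (l₁ ++ s :: l₂)) (ht : t ∈ triangleFaces L)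
    (htl : t ∉ l₁ ++ s :: l₂) (hab : a ≠ b) (has : a ∈ s) (hbs : b ∈ s) (hat : a ∈ t) (hbt : b ∈ t)
    (he : {a, b} ∈ L.faces) (hm : m = midpoint ℝ a b)
    (hpre : ∀ p ∈ l₁.getLast?, s.erase b ⊆ p) (hpost : ∀ q ∈ l₂.head?, s.erase a ⊆ q) :
    IsPartialStrip (bisect L a b m hab he hm) (l₁ ++ (insert m (s.erase b) ::
      insert m (t.erase b) :: insert m (t.erase a) :: insert m (s.erase a) :: l₂)) ∧
    ∀ x, (x ∈ triangleFaces (bisect L a b m hab he hm) ∧ x ∉ l₁ ++ (insert m (s.erase b) ::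
      insert m (t.erase b) :: insert m (t.erase a) :: insert m (s.erase a) :: l₂)) ↔
      x ∈ triangleFaces L ∧ x ∉ l₁ ++ s :: l₂ ∧ x ≠ t := by
  have hs : s ∈ triangleFaces L := hl.mem s (by simp)
  have hst : s ≠ t := by rintro rfl; simp at htl
  have hnot := fun u (hu : u ∈ triangleFaces L) => midpoint_notMem_face hab he hm hu.1
  have htri := fun u => mem_triangleFaces_bisect hL hab he hm (t := u)
  have htwo := fun u (hu : u ∈ triangleFaces L) (hau : a ∈ u) (hbu : b ∈ u) =>
    eq_or_eq_of_ends_mem hL hab hs ht hst has hbs hat hbt hu hau hbu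
  have hms := hnot s hs
  have hmt := hnot t ht
  have hml : ∀ u ∈ l₁ ++ s :: l₂, m ∉ u := fun u hu => hnot u (hl.mem u hu)
  have hnd := hl.nodup
  -- Only `s` and `t` contain the bisected edge, so all other triangles of the strip survive.
  have hold : ∀ u ∈ l₁ ++ s :: l₂, u ≠ s → ¬ (a ∈ u ∧ b ∈ u) := by
    rintro u hu hus ⟨hau, hbu⟩
    rcases htwo u (hl.mem u hu) hau hbu with h | h
    · exact hus h
    · exact htl (h ▸ hu)
  have hc1 := hasCommonEdge_across has hbs hat hbt hab hms hmt hst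
  have hc2 := (hasCommonEdge_halves ht.2 hat hbt hab hmt).symm
  have hc3 := (hasCommonEdge_across hbs has hbt hat hab.symm hms hmt hst).symm
  have hc4 := (hasCommonEdge_halves hs.2 has hbs hab hms).symm
  have hd : insert m (s.erase b) ≠ insert m (t.erase a) := by
    intro h
    have : a ∈ insert m (t.erase a) := by
      rw [← h]
      grind
    grind
  have hd' : insert m (t.erase b) ≠ insert m (s.erase a) := by
    intro h
    have : a ∈ insert m (s.erase a) := by
      rw [← h]
      grind
    grind
  have hrest : ∀ x, (x ∈ triangleFaces (bisect L a b m hab he hm) ∧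
      x ∉ l₁ ++ (insert m (s.erase b) :: insert m (t.erase b) :: insert m (t.erase a) ::
        insert m (s.erase a) :: l₂)) ↔
      x ∈ triangleFaces L ∧ x ∉ l₁ ++ s :: l₂ ∧ x ≠ t := by
    intro x
    constructor
    · rintro ⟨hx, hxl⟩
      simp only [List.mem_append, List.mem_cons, not_or] at hxl ⊢
      rcases (htri x).1 hx with ⟨h, hn⟩ | ⟨u, hu, ha, hb, h⟩
      · refine ⟨h, ⟨hxl.1, ?_, hxl.2.2.2.2.2⟩, ?_⟩
        · rintro rfl
          exact hn ⟨has, hbs⟩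
        · rintro rfl
          exact hn ⟨hat, hbt⟩
      · exfalso
        rcases htwo u hu ha hb with rfl | rfl <;> rcases h with h | h <;> simp [h] at hxl
    · rintro ⟨hx, hxl, hxt⟩
      have hmx := hnot x hx
      refine ⟨(htri x).2 (Or.inl ⟨hx, ?_⟩), ?_⟩
      · rintro ⟨ha, hb⟩
        rcases htwo x hx ha hb with rfl | rfl
        · simp at hxl
        · exact hxt rfl
      · have h : ∀ y, x ≠ insert m y := by
          rintro y rfl
          simp at hmx
        simp only [List.mem_append, List.mem_cons, not_or] at hxl ⊢
        exact ⟨hxl.1, h _, h _, h _, h _, hxl.2.2⟩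
  refine ⟨⟨?_, ?_, ?_, ?_⟩, hrest⟩
  · have hins : ∀ y, insert m y ∉ l₁ ++ s :: l₂ := fun y hy => hml _ hy (Finset.mem_insert_self m y)
    simp only [List.mem_append, List.mem_cons, not_or] at hins
    rw [List.nodup_append] at hnd ⊢
    simp only [List.nodup_cons, List.mem_cons, not_or] at hnd ⊢
    refine ⟨hnd.1, ⟨⟨hc1.1, hd, hc4.1.symm ∘ Eq.symm, (hins _).2.2⟩,
      ⟨hc2.1, hd', (hins _).2.2⟩, ⟨hc3.1, (hins _).2.2⟩, (hins _).2.2, hnd.2.1.2⟩, ?_⟩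
    rintro x hx y (rfl | rfl | rfl | rfl | hy) rfl
    · exact (hins _).1 hx
    · exact (hins _).1 hx
    · exact (hins _).1 hx
    · exact (hins _).1 hx
    · exact hnd.2.2 x hx x (Or.inr hy) rfl
  · have hin : ∀ u ∈ l₁ ++ s :: l₂, u ≠ s → u ∈ triangleFaces (bisect L a b m hab he hm) :=
      fun u hu hus => (htri u).2 (Or.inl ⟨hl.mem u hu, hold u hu hus⟩)
    rw [List.nodup_append, List.nodup_cons] at hnd
    intro u hu
    simp only [List.mem_append, List.mem_cons] at hu
    rcases hu with hu | rfl | rfl | rfl | rfl | hu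
    · exact hin u (by simp [hu]) (hnd.2.2 u hu s (by simp))
    · exact (htri _).2 (Or.inr ⟨s, hs, has, hbs, Or.inr rfl⟩)
    · exact (htri _).2 (Or.inr ⟨t, ht, hat, hbt, Or.inr rfl⟩)
    · exact (htri _).2 (Or.inr ⟨t, ht, hat, hbt, Or.inl rfl⟩)
    · exact (htri _).2 (Or.inr ⟨s, hs, has, hbs, Or.inl rfl⟩)
    · refine hin u (by simp [hu]) ?_
      rintro rfl
      exact hnd.2.1.1 hu
  · have hch := hl.chain
    rw [List.isChain_append, List.isChain_cons] at hch
    rw [List.isChain_append]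
    refine ⟨hch.1, ?_, ?_⟩
    · refine List.IsChain.cons_cons hc1 (List.IsChain.cons_cons hc2 (List.IsChain.cons_cons hc3 ?_))
      rw [List.isChain_cons]
      refine ⟨fun q hq => ?_, hch.2.1.2⟩
      have hql : q ∈ l₁ ++ s :: l₂ := by simp [List.mem_of_mem_head? hq]
      exact (hasCommonEdge_insert_erase hs.2 has (hml q hql) (hpost q hq)).symm
    · intro p hp x hx
      have hpl : p ∈ l₁ ++ s :: l₂ := by simp [List.mem_of_mem_getLast? hp]
      simp only [List.head?_cons, Option.mem_def, Option.some.injEq] at hx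
      subst hx
      exact hasCommonEdge_insert_erase hs.2 hbs (hml p hpl) (hpre p hp)
  · intro A hA hAr
    have hAr' := fun x (hx : x ∈ A) => (hrest x).1 (hAr x hx)
    obtain ⟨x, hx, y, hy, hyA, hxy⟩ := hl.attached A hA fun x hx =>
      ⟨(hAr' x hx).1, (hAr' x hx).2.1⟩
    by_cases hyab : a ∈ y ∧ b ∈ y
    · obtain ⟨hne, f, hf, hfx, hfy⟩ := hxy
      have hxab : ¬ (a ∈ x ∧ b ∈ x) := by
        rintro ⟨ha, hb⟩
        rcases htwo x (hAr' x hx).1 ha hb with h | h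
        · exact (hAr' x hx).2.1 (by simp [h])
        · exact (hAr' x hx).2.2 h
      -- The neighbour `y` is cut, but its side `f` is not the bisected edge. The half of `y` that
      -- omits `z` keeps all of `f` and takes over the adjacency to `x`.
      have hz : ∃ z, (z = a ∨ z = b) ∧ z ∉ f := by
        by_contra! h
        exact hxab ⟨hfx (h a (Or.inl rfl)), hfx (h b (Or.inr rfl))⟩
      obtain ⟨z, hz, hzf⟩ := hz
      have hmem : insert m (y.erase z) ∉ triangleFaces L := fun h =>
        hnot _ h (Finset.mem_insert_self _ _)
      refine ⟨x, hx, insert m (y.erase z), (htri _).2 (Or.inr ⟨y, hy, hyab.1, hyab.2, ?_⟩),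
        fun h => hmem (hAr' _ h).1, fun h => hmem (h ▸ (hAr' x hx).1), f, hf, hfx, ?_⟩
      · rcases hz with rfl | rfl
        exacts [Or.inl rfl, Or.inr rfl]
      · exact (Finset.subset_erase.2 ⟨hfy, hzf⟩).trans (Finset.subset_insert _ _)
    · exact ⟨x, hx, y, (htri y).2 (Or.inl ⟨hy, hyab⟩), hyA, hxy⟩

/-- A partial strip that misses a triangle extends, after bisecting an edge of a missing triangle,
by three triangles, whereby the number of missing triangles drops by one. -/
theorem IsPartialStrip.exists_bisect (hL : IsTriangulated L) {l : List (Finset E)}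
    (hl : IsPartialStrip L l) (hne : ∃ t ∈ triangleFaces L, t ∉ l) :
    ∃ t ∈ triangleFaces L, t ∉ l ∧ ∃ (a b : E) (hab : a ≠ b) (he : {a, b} ∈ L.faces)
      (l' : List (Finset E)), a ∈ t ∧ b ∈ t ∧
      IsPartialStrip (bisect L a b (midpoint ℝ a b) hab he rfl) l' ∧ l'.length = l.length + 3 ∧
      ∀ x, (x ∈ triangleFaces (bisect L a b (midpoint ℝ a b) hab he rfl) ∧ x ∉ l') ↔
        x ∈ triangleFaces L ∧ x ∉ l ∧ x ≠ t := by
  obtain ⟨t, ⟨ht, htl⟩, s, hs, hsA, -, e, he2, het, hes⟩ :=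
    hl.attached {t | t ∈ triangleFaces L ∧ t ∉ l} hne fun t ht => ht
  have hsl : s ∈ l := by
    by_contra h
    exact hsA ⟨hs, h⟩
  obtain ⟨l₁, l₂, rfl⟩ := List.append_of_mem hsl
  obtain ⟨a, b, hab, rfl⟩ := Finset.card_eq_two.1 he2
  have he : {a, b} ∈ L.faces := L.down_closed ht.1 het (by simp)
  have hat : a ∈ t := het (by simp)
  have hbt : b ∈ t := het (by simp)
  have has : a ∈ s := hes (by simp)
  have hbs : b ∈ s := hes (by simp)
  have hst : s ≠ t := by
    rintro rfl
    exact htl hsl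
  have hnd := hl.nodup
  have hch := hl.chain
  rw [List.nodup_append, List.nodup_cons] at hnd
  rw [List.isChain_append, List.isChain_cons] at hch
  -- The side `{a, b}` of `s` is taken by `t`, which is off the strip, so the strip enters and
  -- leaves `s` through the other two sides.
  have hside : ∀ p ∈ l₁ ++ s :: l₂, HasCommonEdge p s → s.erase b ⊆ p ∨ s.erase a ⊆ p := by
    rintro p hp ⟨hps, f, hf, hfp, hfs⟩
    have hpn : ¬ (a ∈ p ∧ b ∈ p) := by
      rintro ⟨ha, hb⟩
      rcases eq_or_eq_of_ends_mem hL hab hs ht hst has hbs hat hbt (hl.mem p hp) ha hb with h | h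
      · exact hps h
      · exact htl (h ▸ hp)
    have key : ∀ z ∈ s, z ∉ f → s.erase z ⊆ p := by
      intro z hz hzf
      have : f = s.erase z := Finset.eq_of_subset_of_card_le
        (Finset.subset_erase.2 ⟨hfs, hzf⟩) (by rw [Finset.card_erase_of_mem hz, hs.2, hf])
      rwa [← this]
    by_cases haf : a ∈ f
    · exact Or.inl (key b hbs fun hbf => hpn ⟨hfp haf, hfp hbf⟩)
    · exact Or.inr (key a has haf)
  have hsp : ∀ p ∈ l₁.getLast?, p ∈ l₁ ∧ (s.erase b ⊆ p ∨ s.erase a ⊆ p) := fun p hp =>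
    have h := List.mem_of_mem_getLast? hp
    ⟨h, hside p (by simp [h]) (hch.2.2 p hp s (by simp))⟩
  have hsq : ∀ q ∈ l₂.head?, q ∈ l₂ ∧ (s.erase b ⊆ q ∨ s.erase a ⊆ q) := fun q hq =>
    have h := List.mem_of_mem_head? hq
    ⟨h, hside q (by simp [h]) (hch.2.1.1 q hq).symm⟩
  -- Entry and exit use different sides, since otherwise three triangles would share one. Up to
  -- exchanging `a` and `b`, this is the oriented situation.
  have hdiff : ∀ p ∈ l₁, ∀ q ∈ l₂, ∀ z ∈ s, s.erase z ⊆ p → s.erase z ⊆ q → False := by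
    intro p hp q hq z hz hzp hzq
    refine hL.not_three (by rw [Finset.card_erase_of_mem hz, hs.2]) hs (hl.mem p (by simp [hp]))
      (hl.mem q (by simp [hq])) (Finset.erase_subset z s) hzp hzq
      (hnd.2.2 p hp s (by simp)).symm ?_ (hnd.2.2 p hp q (by simp [hq]))
    rintro rfl
    exact hnd.2.1.1 hq
  have horient : ((∀ p ∈ l₁.getLast?, s.erase b ⊆ p) ∧ ∀ q ∈ l₂.head?, s.erase a ⊆ q) ∨
      ((∀ p ∈ l₁.getLast?, s.erase a ⊆ p) ∧ ∀ q ∈ l₂.head?, s.erase b ⊆ q) := by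
    by_contra! h
    obtain ⟨h1, h2⟩ := h
    by_cases hp : ∀ p ∈ l₁.getLast?, s.erase b ⊆ p
    · obtain ⟨q, hq, hqa⟩ := h1 hp
      have hqb := (hsq q hq).2.resolve_right hqa
      by_cases hp' : ∀ p ∈ l₁.getLast?, s.erase a ⊆ p
      · obtain ⟨q', hq', hqb'⟩ := h2 hp'
        rw [Option.mem_unique hq' hq] at hqb'
        exact hqb' hqb
      · push Not at hp'
        obtain ⟨p, hpl, -⟩ := hp'
        exact hdiff p (hsp p hpl).1 q (hsq q hq).1 b hbs (hp p hpl) hqb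
    · push Not at hp
      obtain ⟨p, hpl, hpb⟩ := hp
      have hpa := (hsp p hpl).2.resolve_left hpb
      obtain ⟨q, hq, hqb⟩ := h2 fun p' hp' => by rwa [Option.mem_unique hp' hpl]
      have hqa := (hsq q hq).2.resolve_left hqb
      exact hdiff p (hsp p hpl).1 q (hsq q hq).1 a has hpa hqa
  rcases horient with ⟨h1, h2⟩ | ⟨h1, h2⟩
  · obtain ⟨h3, h4⟩ := hl.bisect_of_oriented hL ht htl hab has hbs hat hbt he rfl h1 h2
    exact ⟨t, ht, htl, a, b, hab, he, _, hat, hbt, h3, by simp; omega, h4⟩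
  · obtain ⟨h3, h4⟩ := hl.bisect_of_oriented hL ht htl hab.symm hbs has hbt hat
      (by rwa [Finset.pair_comm]) rfl h1 h2
    exact ⟨t, ht, htl, b, a, hab.symm, _, _, hbt, hat, h3, by simp; omega, h4⟩

end PartialStrip

/-! ### Assembling the strip of a subdivision -/

variable {d : ℕ}

theorem IsModel.isTriangulated {K : Complex d} (hK : IsModel K) : IsTriangulated K :=
  ⟨hK.finite, hK.pure, hK.edge_le_two⟩

theorem IsTriangulated.isModel {K : Complex d} (hK : IsTriangulated K) : IsModel K :=
  ⟨hK.finite, hK.pure, hK.edge_le_two⟩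

theorem IsSubdivision.refl (K : Complex d) : IsSubdivision K K :=
  ⟨rfl, fun s hs => ⟨s, hs, subset_rfl⟩, fun _ hx => Or.inl hx⟩

theorem IsSubdivision.bisect [DecidableEq (Space d)] {K L : Complex d} (hKL : IsSubdivision K L)
    {a b : Space d} (hab : a ≠ b) (he : {a, b} ∈ L.faces) (heK : {a, b} ∈ K.faces) :
    IsSubdivision K (bisect L a b (midpoint ℝ a b) hab he rfl) where
  space_eq := by rw [bisect_space, hKL.space_eq]
  refines := by
    intro s hs
    obtain ⟨t, ht, hst⟩ := bisect_refines hab he rfl hs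
    obtain ⟨u, hu, htu⟩ := hKL.refines t ht
    exact ⟨u, hu, hst.trans htu⟩
  midpoints := by
    intro x hx
    rcases bisect_vertices hab he rfl hx with h | h
    · exact hKL.midpoints x h
    · exact Or.inr ⟨{a, b}, heK, Finset.card_pair hab, a, by simp, b, by simp, hab, h⟩

/-- A partial strip extends to a single strip of a subdivision, with three more triangles for each
missing one. -/
theorem exists_strip_of_isPartialStrip {K L : Complex d} (hL : IsTriangulated L)
    (hKL : IsSubdivision K L) {l : List (Finset (Space d))} (hl : IsPartialStrip L l)
    {R : Finset (Finset (Space d))} (hR : ∀ t, t ∈ R ↔ t ∈ triangleFaces L ∧ t ∉ l)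
    (hRK : ∀ t ∈ R, t ∈ triangleFaces K) :
    ∃ (L' : Complex d) (l' : List (Finset (Space d))), IsModel L' ∧ IsSubdivision K L' ∧
      IsStrip L' l' ∧ l'.length = l.length + 3 * R.card := by
  classical
  induction hn : R.card generalizing L l R with
  | zero =>
    refine ⟨L, l, hL.isModel, hKL, ⟨hl.nodup, fun t => ⟨hl.mem t, fun ht => ?_⟩, hl.chain⟩, rfl⟩
    by_contra htl
    have := (hR t).2 ⟨ht, htl⟩
    simp [Finset.card_eq_zero.1 hn] at this
  | succ n ih =>
    obtain ⟨t₀, ht₀⟩ := Finset.card_pos.1 (by omega : 0 < R.card)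
    obtain ⟨t, ht, htl, a, b, hab, he, l', ha, hb, hl', hlen, hrest⟩ :=
      hl.exists_bisect hL ⟨t₀, (hR t₀).1 ht₀⟩
    have htR := (hR t).2 ⟨ht, htl⟩
    -- Missing triangles are still triangles of `K`, so every bisected edge is an edge of `K`, and
    -- no midpoints of already halved edges arise.
    have heK : {a, b} ∈ K.faces := K.down_closed (hRK t htR).1
      (Finset.insert_subset ha (Finset.singleton_subset_iff.2 hb)) (by simp)
    obtain ⟨L', l'', h1, h2, h3, h4⟩ := ih (hL.bisect hab he rfl) (hKL.bisect hab he heK) hl'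
      (R := R.erase t) (fun x => by
        rw [hrest, Finset.mem_erase, hR]
        tauto) (fun x hx => hRK x (Finset.mem_of_mem_erase hx))
      (by rw [Finset.card_erase_of_mem htR, hn, Nat.add_sub_cancel])
    exact ⟨L', l'', h1, h2, h3, by omega⟩

/-- A walk in the dual graph from inside `X` to outside crosses the boundary of `X` at some step. -/
theorem EdgeConnected.linked [DecidableEq (Finset (Space d))] {K : Complex d}
    (hK : EdgeConnected K) {S : Finset (Finset (Space d))} (hS : ∀ t, t ∈ S ↔ t ∈ triangles K) :
    Linked HasCommonEdge S := by
  intro X hX hne hXS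
  obtain ⟨x, hx⟩ := hne
  obtain ⟨y, hyS, hyX⟩ := Finset.exists_of_ssubset (hX.ssubset_of_ne hXS)
  obtain ⟨p⟩ := hK.preconnected ⟨x, (hS x).1 (hX hx)⟩ ⟨y, (hS y).1 hyS⟩
  obtain ⟨e, -, h1, h2⟩ := p.exists_boundary_dart {t | t.1 ∈ X} hx hyX
  exact ⟨e.fst.1, h1, e.snd.1, Finset.mem_sdiff.2 ⟨(hS _).2 e.snd.2, h2⟩, e.adj⟩

end Strip

theorem theorem4 :
    ∃ C : ℝ, ∀ (d n : ℕ) (K : Strip.Complex d),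
      Strip.IsModel K → Strip.EdgeConnected K → (Strip.triangles K).ncard = n →
        ∃ (L : Strip.Complex d) (l : List (Finset (Strip.Space d))),
          Strip.IsModel L ∧ Strip.IsSubdivision K L ∧ Strip.IsStrip L l ∧
            (l.length : ℝ) ≤ 3 * (n : ℝ) - 4 * Real.logb 2 (n : ℝ) + C := by
  classical
  -- The path falls short of `2 log₂ n` by at most 3, and each of its triangles counts twice in `3 n
  -- - 2 k`.
  refine ⟨6, fun d n K hK hconn hn => ?_⟩
  have hfin : (Strip.triangles K).Finite := hK.finite.subset fun t ht => ht.1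
  have hS : ∀ t, t ∈ hfin.toFinset ↔ t ∈ Strip.triangles K := fun t => hfin.mem_toFinset
  have hcard : hfin.toFinset.card = n := by rw [← hn, Set.ncard_eq_toFinset_card _ hfin]
  generalize hfin.toFinset = S at hS hcard
  have hlinked := hconn.linked hS
  have hne : S.Nonempty := by
    obtain ⟨t⟩ := hconn.nonempty
    exact ⟨t.1, (hS _).2 t.2⟩
  obtain ⟨l, hl, hlS, hnd, hch, hlong⟩ := hlinked.exists_long_path
    (fun _ _ => Strip.HasCommonEdge.symm) hne fun x hx N hN hxN =>
      hK.isTriangulated.card_neighbours_le ((hS x).1 hx) (fun t ht => (hS t).1 (hN ht)) hxN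
  have hpartial : Strip.IsPartialStrip K l := by
    refine ⟨hnd, fun t ht => (hS t).1 (hlS t ht), hch, fun A ⟨t, ht⟩ hA => ?_⟩
    -- The path is nonempty, so a set of missing triangles is never all of `S`.
    obtain ⟨x, hx, y, hy, hxy⟩ := hlinked (S.filter (· ∈ A)) (Finset.filter_subset _ _)
      ⟨t, Finset.mem_filter.2 ⟨(hS t).2 (hA t ht).1, ht⟩⟩ (by
        obtain ⟨z, hz⟩ := List.exists_mem_of_ne_nil l hl
        intro h
        rw [Finset.filter_eq_self] at h
        exact (hA z (h z (hlS z hz))).2 hz)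
    simp only [Finset.mem_sdiff, Finset.mem_filter, not_and] at hx hy
    exact ⟨x, hx.2, y, (hS y).1 hy.1, hy.2 hy.1, hxy⟩
  obtain ⟨L, l', h1, h2, h3, h4⟩ := Strip.exists_strip_of_isPartialStrip hK.isTriangulated
    (Strip.IsSubdivision.refl K) hpartial (R := S \ l.toFinset)
    (fun t => by rw [Finset.mem_sdiff, hS, List.mem_toFinset]; rfl)
    (fun t ht => (hS t).1 (Finset.mem_sdiff.1 ht).1)
  refine ⟨L, l', h1, h2, h3, ?_⟩
  have hsub : l.toFinset ⊆ S := fun t ht => hlS t (List.mem_toFinset.1 ht)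
  have hm : l.toFinset.card = l.length := List.toFinset_card_of_nodup hnd
  have hle := Finset.card_le_card hsub
  rw [Finset.card_sdiff_of_subset hsub, hm, hcard] at h4
  rw [hm, hcard] at hle
  have hlen : (l'.length : ℝ) = 3 * n - 2 * l.length := by
    have : l'.length + 2 * l.length = 3 * n := by omega
    have : (l'.length : ℝ) + 2 * l.length = 3 * n := mod_cast this
    linarith
  have hn0 : 0 < n := hcard ▸ hne.card_pos
  have hlog : 2 * Real.logb 2 n ≤ l.length + 3 := by
    have h : (n : ℝ) ^ 2 ≤ 2 ^ (l.length + 3) := by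
      rw [hcard] at hlong
      exact_mod_cast hlong
    have := Real.logb_le_logb_of_le (b := 2) (by norm_num) (by positivity) h
    rw [Real.logb_pow, Real.logb_pow, Real.logb_self_eq_one (by norm_num)] at this
    push_cast at this
    linarith
  linarith
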